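/- Let $F$ be a non-empty compact subset of $\mathbb{R}$. A set $A\subseteq F$ is $r$-separated if $|x-y|\ge r$ for all distinct $x,y\in A$. A choice of abstract rationals in $F$ is a family $(P(q))_{q\ge 1}$ such that, for every integer $q \ge 1$, $P(q)$ is a maximal (with respect to inclusion) $(1/q)$-separated subset of $F$. Given such a choice and $t>0$, let \[ F_t=\{x\in F:\ \text{for infinitely many } q \text{ there is } p\in P(q) \text{ with } |p-x|\le q^{-t}\}. \] Write $\dim_{\mathrm H}$ for Hausdorff dimension and $\dim_{\mathrm P}$ for packing dimension, \[ \dim_{\mathrm P}X=\inf\Big\{\sup_i\overline{\dim}_{\mathrm B}X_i:\ X=\bigcup_{i=1}^{\infty}X_i\Big\},\qquad \overline{\dim}_{\mathrm B}X=\limsup_{r\to0^+}\frac{\log N_r(X)}{-\log r}, \] where $N_r(X)$ is the largest cardinality of an $r$-separated subset of $X$. **Proposition.** For every real $t>2$ there exist a non-empty compact set $F\subseteq[0,1]$ and a choice of abstract rationals in $F$ such that \[ \dim_{\mathrm P}F=1\qquad\text{and}\qquad \dim_{\mathrm H}F_t=\dim_{\mathrm H}F=\frac2t=\frac{\dim_{\mathrm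 P}F+1}{t}. \] In particular, $\dim_{\mathrm H}F_t>(\dim_{\mathrm H}F+1)/t$ for this $F$, so that in the general upper bound $\dim_{\mathrm H}F_t\le(\dim_{\mathrm P}F+1)/t$, valid for every choice of abstract rationals and every $t\ge1$, the packing dimension cannot be replaced by the Hausdorff dimension. -/

import Mathlib

open Set Filter Topology

noncomputable section

/-- A set `A` is `r`-separated if distinct points of `A` are at distance at least `r`
(non-strict inequality, unlike Mathlib's `Metric.IsSeparated`). -/
def RSeparated {X : Type*} [MetricSpace X] (r : ℝ) (A : Set X) : Prop :=
  ∀ x ∈ A, ∀ y ∈ A, x ≠ y → r ≤ dist x y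

/-- `P` is a choice of abstract rationals in `F`: for every `q ≥ 1`, the set `P q` is a maximal
`(1/q)`-separated subset of `F`. The value `P 0` is irrelevant. -/
def IsAbstractRationals {X : Type*} [MetricSpace X] (F : Set X) (P : ℕ → Set X) : Prop :=
  ∀ q : ℕ, 1 ≤ q → Maximal (fun A : Set X => A ⊆ F ∧ RSeparated (1 / (q : ℝ)) A) (P q)

/-- The set `F_t` of points `x` of `F` such that, for infinitely many `q`, there is `p ∈ P q`
with `d(p, x) ≤ 1 / q ^ t`. -/
def approxSet {X : Type*} [MetricSpace X] (F : Set X) (P : ℕ → Set X) (t : ℝ) : Set X :=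
  {x ∈ F | ∀ N : ℕ, ∃ q : ℕ, N < q ∧ ∃ p ∈ P q, dist p x ≤ 1 / (q : ℝ) ^ t}

/-- The largest cardinality `N_r(A)` of an `r`-separated subset of `A` (possibly infinite). -/
def sepNumber {X : Type*} [MetricSpace X] (r : ℝ) (A : Set X) : ℕ∞ :=
  ⨆ (S : Set X) (_ : S ⊆ A) (_ : RSeparated r S), S.encard

/-- The upper box dimension `limsup_{r → 0+} log N_r(A) / (-log r)`, as an extended real
(it is `⊥` for the empty set and `⊤` for a set that is not totally bounded). -/
def upperBoxDim {X : Type*} [MetricSpace X] (A : Set X) : EReal :=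
  limsup (fun r : ℝ => ENNReal.log (sepNumber r A : ENNReal) / ((-Real.log r : ℝ) : EReal))
    (𝓝[>] (0 : ℝ))

/-- The packing dimension: the infimum, over all countable decompositions `A = ⋃ i, B i`, of the
supremum of the upper box dimensions of the pieces. -/
def packingDim {X : Type*} [MetricSpace X] (A : Set X) : EReal :=
  ⨅ (B : ℕ → Set X) (_ : A = ⋃ i, B i), ⨆ i, upperBoxDim (B i)

end

/-! `F` consists of the binary expansions whose digits are free in blocks `[m_k, 2 n_k)` and zero in
the gaps `[2 n_k, m_{k+1})`, where `n_k = (k+1)(m_k+1)` and `m_{k+1}` is about `t (n_k + 1)`.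

The proportion of free digits among the first `m` is asymptotically lowest at `m = m_{k+1}`, where
it is close to `2/t`; this gives the Hausdorff dimension (`le_dimH_digitSet`,
`dimH_digitSet_freeDigits_le`). At `m = 2 n_k` the proportion tends to 1. This persists in every
cylinder, so Baire's theorem gives packing dimension 1 (`one_le_upperBoxDim`,
`packingDim_digitSet_freeDigits`).

The gaps put every `x` in `F` within `2^(-m_{k+1})` of its truncation `j / 4^n`, `n = n_k`, which
lies in `F`. The roughly `2^n` values of `q` of size `2^n` share these `4^n` candidates by residue
class: those with `j ≡ q` modulo `2^n` are `2^(-n)`-separated, hence extend to an admissible `P q`.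
Since `q^t ≤ 2^(m_{k+1})`, each `x` is approximated for infinitely many `q`, so `F_t = F`
(`approxSet_digitSet_freeDigits`). -/

/-- The integer whose binary digits, most significant first, are `a 0, …, a (n - 1)`. -/
def prefixNum (a : ℕ → Fin 2) : ℕ → ℕ
  | 0 => 0
  | n + 1 => 2 * prefixNum a n + a n

open Classical in
/-- Replace the digits outside `S` by zero. -/
noncomputable def maskDigits (S : Set ℕ) (a : ℕ → Fin 2) : ℕ → Fin 2 :=
  fun i => if i ∈ S then a i else 0

/-- The real numbers having a binary expansion whose nonzero digits sit at positions in `S`. -/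
def digitSet (S : Set ℕ) : Set ℝ :=
  range fun a : ℕ → Fin 2 => Real.ofDigits (maskDigits S a)

theorem maskDigits_of_mem {S : Set ℕ} (a : ℕ → Fin 2) {i : ℕ} (h : i ∈ S) :
    maskDigits S a i = a i := if_pos h

theorem maskDigits_of_notMem {S : Set ℕ} (a : ℕ → Fin 2) {i : ℕ} (h : i ∉ S) :
    maskDigits S a i = 0 := if_neg h

theorem maskDigits_eq_self {S : Set ℕ} {a : ℕ → Fin 2} (h : ∀ i ∉ S, a i = 0) :
    maskDigits S a = a := by
  funext i
  by_cases hi : i ∈ S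
  · exact maskDigits_of_mem a hi
  · rw [maskDigits_of_notMem a hi, h i hi]

theorem ofDigits_mem_digitSet {S : Set ℕ} {a : ℕ → Fin 2} (h : ∀ i ∉ S, a i = 0) :
    Real.ofDigits a ∈ digitSet S := ⟨a, by simp only [maskDigits_eq_self h]⟩

theorem continuous_maskDigits (S : Set ℕ) : Continuous (maskDigits S) := by
  refine continuous_pi fun i => ?_
  by_cases hi : i ∈ S
  · simpa only [maskDigits, if_pos hi] using continuous_apply i
  · simpa only [maskDigits, if_neg hi] using continuous_const

theorem continuous_ofDigits_maskDigits (S : Set ℕ) :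
    Continuous fun a : ℕ → Fin 2 => Real.ofDigits (maskDigits S a) :=
  Real.continuous_ofDigits.comp (continuous_maskDigits S)

theorem isCompact_digitSet (S : Set ℕ) : IsCompact (digitSet S) :=
  isCompact_range (continuous_ofDigits_maskDigits S)

theorem digitSet_nonempty (S : Set ℕ) : (digitSet S).Nonempty := range_nonempty _

theorem digitSet_subset_Icc (S : Set ℕ) : digitSet S ⊆ Icc 0 1 := by
  rintro _ ⟨a, rfl⟩
  exact ⟨Real.ofDigits_nonneg _, Real.ofDigits_le_one _⟩

theorem prefixNum_congr {a b : ℕ → Fin 2} {n : ℕ} (h : ∀ i < n, a i = b i) :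
    prefixNum a n = prefixNum b n := by
  induction n with
  | zero => rfl
  | succ n ih =>
    rw [prefixNum, prefixNum, ih fun i hi => h i (by omega), h n (by omega)]

theorem eq_of_prefixNum_eq {a b : ℕ → Fin 2} {n : ℕ} (h : prefixNum a n = prefixNum b n) :
    ∀ i < n, a i = b i := by
  induction n with
  | zero => intro i hi; omega
  | succ n ih =>
    rw [prefixNum, prefixNum] at h
    intro i hi
    have := (a n).isLt
    have := (b n).isLt
    rcases Nat.lt_succ_iff_lt_or_eq.1 hi with hi | rfl
    · exact ih (by omega) i hi
    · exact Fin.ext (by omega)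

theorem prefixNum_lt (a : ℕ → Fin 2) (n : ℕ) : prefixNum a n < 2 ^ n := by
  induction n with
  | zero => simp [prefixNum]
  | succ n ih =>
    have := (a n).isLt
    rw [prefixNum, pow_succ]
    omega

theorem sum_ofDigitsTerm_eq (a : ℕ → Fin 2) (n : ℕ) :
    ∑ i ∈ Finset.range n, Real.ofDigitsTerm a i = prefixNum a n / 2 ^ n := by
  induction n with
  | zero => simp [prefixNum]
  | succ n ih =>
    rw [Finset.sum_range_succ, ih, prefixNum, Real.ofDigitsTerm]
    push_cast
    field_simp
    ring

theorem prefixNum_div_le_ofDigits (a : ℕ → Fin 2) (n : ℕ) :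
    (prefixNum a n : ℝ) / 2 ^ n ≤ Real.ofDigits a := by
  rw [Real.ofDigits_eq_sum_add_ofDigits a n, sum_ofDigitsTerm_eq]
  have := Real.ofDigits_nonneg fun i => a (i + n)
  push_cast
  have : (0 : ℝ) ≤ (2 ^ n)⁻¹ * Real.ofDigits fun i => a (i + n) := by positivity
  linarith

theorem ofDigits_le_prefixNum_div (a : ℕ → Fin 2) (n : ℕ) :
    Real.ofDigits a ≤ ((prefixNum a n : ℝ) + 1) / 2 ^ n := by
  rw [Real.ofDigits_eq_sum_add_ofDigits a n, sum_ofDigitsTerm_eq, add_div, one_div]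
  push_cast
  gcongr
  exact mul_le_of_le_one_right (by positivity) (Real.ofDigits_le_one _)

theorem ofDigits_eq_prefixNum_div {a : ℕ → Fin 2} {n : ℕ} (h : ∀ i, n ≤ i → a i = 0) :
    Real.ofDigits a = prefixNum a n / 2 ^ n := by
  rw [Real.ofDigits_eq_sum_add_ofDigits a n, sum_ofDigitsTerm_eq]
  simp [Real.ofDigits, Real.ofDigitsTerm, h]

/-- If the digits of `a` at positions in `[n, m)` vanish, then `a` is within `2⁻ᵐ` of its
truncation at position `n`. -/
theorem abs_ofDigits_sub_prefixNum_le {a : ℕ → Fin 2} {n m : ℕ}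
    (h : ∀ i, n ≤ i → i < m → a i = 0) :
    |Real.ofDigits a - prefixNum a n / 2 ^ n| ≤ ((2 : ℝ) ^ m)⁻¹ := by
  have h₁ : Real.ofDigits (maskDigits (Iio n) a) = prefixNum a n / 2 ^ n := by
    rw [ofDigits_eq_prefixNum_div (n := n) fun i hi => maskDigits_of_notMem a (by simpa using hi),
      prefixNum_congr fun i hi => maskDigits_of_mem a (mem_Iio.2 hi)]
  rw [← h₁]
  refine Real.abs_ofDigits_sub_ofDigits_le fun i hi => ?_
  by_cases hin : i < n
  · rw [maskDigits_of_mem a (mem_Iio.2 hin)]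
  · rw [maskDigits_of_notMem a (by simpa using hin), h i (by omega) hi]

theorem prefixNum_div_mem_digitSet (S : Set ℕ) (a : ℕ → Fin 2) (n : ℕ) :
    (prefixNum (maskDigits S a) n : ℝ) / 2 ^ n ∈ digitSet S := by
  have h₁ : Real.ofDigits (maskDigits (Iio n) (maskDigits S a)) =
      prefixNum (maskDigits S a) n / 2 ^ n := by
    rw [ofDigits_eq_prefixNum_div (n := n) fun i hi => maskDigits_of_notMem _ (by simpa using hi),
      prefixNum_congr fun i hi => maskDigits_of_mem _ (mem_Iio.2 hi)]
  rw [← h₁]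
  refine ofDigits_mem_digitSet fun i hi => ?_
  by_cases hin : i < n
  · rw [maskDigits_of_mem _ (mem_Iio.2 hin), maskDigits_of_notMem _ hi]
  · exact maskDigits_of_notMem _ (by simpa using hin)

theorem exists_digits_block (a : ℕ → Fin 2) (m l : ℕ) {j : ℕ} (hj : j < 2 ^ l) :
    ∃ b : ℕ → Fin 2, (∀ i < m, b i = a i) ∧ (∀ i, m + l ≤ i → b i = 0) ∧
      prefixNum b (m + l) = prefixNum a m * 2 ^ l + j := by
  induction l generalizing j with
  | zero =>
    refine ⟨maskDigits (Iio m) a, fun i hi => maskDigits_of_mem a (mem_Iio.2 hi),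
      fun i hi => maskDigits_of_notMem a (by simpa using hi), ?_⟩
    rw [add_zero, prefixNum_congr fun i hi => maskDigits_of_mem a (mem_Iio.2 hi)]
    simp at hj
    simp [hj]
  | succ l ih =>
    rw [pow_succ] at hj
    obtain ⟨b, hb₁, hb₂, hb₃⟩ := ih (j := j / 2) (by omega)
    refine ⟨Function.update b (m + l) ⟨j % 2, by omega⟩, fun i hi => ?_, fun i hi => ?_, ?_⟩
    · rw [Function.update_of_ne (by omega), hb₁ i hi]
    · rw [Function.update_of_ne (by omega), hb₂ i (by omega)]
    · rw [← add_assoc, prefixNum,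
        prefixNum_congr fun i hi => Function.update_of_ne (ne_of_lt hi) _ b, hb₃,
        Function.update_self, pow_succ]
      have := Nat.div_add_mod j 2
      simp only
      linarith

/-! ### Blocks of free digits and gaps -/

/-- The positions at which the blocks of free digits start. -/
noncomputable def blockStart (t : ℝ) : ℕ → ℕ
  | 0 => 0
  -- The product is `blockEnd t k` written out, since that definition depends on this recursion.
  | k + 1 => ⌈t * (((k + 1) * (blockStart t k + 1) : ℕ) + 1)⌉₊

/-- Half of the position at which the `k`-th block of free digits ends. -/
noncomputable def blockEnd (t : ℝ) (k : ℕ) : ℕ := (k + 1) * (blockStart t k + 1)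

/-- The positions of the free digits. -/
def freeDigits (t : ℝ) : Set ℕ := ⋃ k, Ico (blockStart t k) (2 * blockEnd t k)

theorem mul_blockEnd_le (t : ℝ) (k : ℕ) : t * ((blockEnd t k : ℝ) + 1) ≤ blockStart t (k + 1) :=
  Nat.le_ceil _

theorem blockStart_succ_le {t : ℝ} (ht : 2 < t) (k : ℕ) :
    (blockStart t (k + 1) : ℝ) ≤ t * ((blockEnd t k : ℝ) + 1) + 1 :=
  (Nat.ceil_lt_add_one (by positivity)).le

theorem lt_blockEnd (t : ℝ) (k : ℕ) : k < blockEnd t k := by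
  rw [blockEnd]; nlinarith

theorem blockStart_lt_blockEnd (t : ℝ) (k : ℕ) : blockStart t k < blockEnd t k := by
  rw [blockEnd]; nlinarith

theorem two_mul_blockEnd_le {t : ℝ} (ht : 2 < t) (k : ℕ) :
    2 * blockEnd t k ≤ blockStart t (k + 1) := by
  have h := mul_blockEnd_le t k
  have h₂ : (0 : ℝ) ≤ blockEnd t k := by positivity
  have : (2 * blockEnd t k : ℝ) ≤ blockStart t (k + 1) := by nlinarith
  exact_mod_cast this

theorem blockStart_mono {t : ℝ} (ht : 2 < t) : Monotone (blockStart t) :=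
  monotone_nat_of_le_succ fun k => by
    have := two_mul_blockEnd_le ht k
    have := blockStart_lt_blockEnd t k
    omega

theorem le_blockStart {t : ℝ} (ht : 2 < t) (k : ℕ) : k ≤ blockStart t k := by
  cases k with
  | zero => exact Nat.zero_le _
  | succ k =>
    have := two_mul_blockEnd_le ht k
    have := lt_blockEnd t k
    omega

theorem notMem_freeDigits {t : ℝ} (ht : 2 < t) {k i : ℕ} (h₁ : 2 * blockEnd t k ≤ i)
    (h₂ : i < blockStart t (k + 1)) : i ∉ freeDigits t := by
  simp only [freeDigits, mem_iUnion, mem_Ico, not_exists, not_and, not_lt]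
  intro l hl
  rcases le_or_gt l k with hlk | hlk
  · rcases hlk.eq_or_lt with rfl | hlk
    · exact h₁
    · have := two_mul_blockEnd_le ht l
      have := blockStart_mono ht (show l + 1 ≤ k from hlk)
      have := blockStart_lt_blockEnd t k
      omega
  · have := blockStart_mono ht (show k + 1 ≤ l from hlk)
    omega

theorem Ico_subset_freeDigits (t : ℝ) (k : ℕ) :
    Ico (blockStart t k) (2 * blockEnd t k) ⊆ freeDigits t :=
  subset_iUnion (fun k => Ico (blockStart t k) (2 * blockEnd t k)) k

/-! ### Counting free digits -/

open Classical in
/-- The elements of `S` below `m`. -/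
noncomputable def initialPart (S : Set ℕ) (m : ℕ) : Finset ℕ := {i ∈ Finset.range m | i ∈ S}

theorem mem_initialPart {S : Set ℕ} {m i : ℕ} : i ∈ initialPart S m ↔ i < m ∧ i ∈ S := by
  simp [initialPart]

theorem card_initialPart_mono (S : Set ℕ) : Monotone fun m => (initialPart S m).card :=
  fun a b hab => Finset.card_le_card fun i hi => by
    rw [mem_initialPart] at hi ⊢
    exact ⟨hi.1.trans_le hab, hi.2⟩

theorem card_initialPart_add_le {S : Set ℕ} {a m : ℕ} (ham : a ≤ m) (h : Ico a m ⊆ S) :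
    (initialPart S a).card + (m - a) ≤ (initialPart S m).card := by
  have hd : Disjoint (initialPart S a) (Finset.Ico a m) := by
    rw [Finset.disjoint_left]
    intro i hi hi'
    rw [mem_initialPart] at hi
    rw [Finset.mem_Ico] at hi'
    omega
  rw [← Nat.card_Ico, ← Finset.card_union_of_disjoint hd]
  refine Finset.card_le_card fun i hi => ?_
  rw [Finset.mem_union, mem_initialPart, Finset.mem_Ico] at hi
  rw [mem_initialPart]
  rcases hi with hi | hi
  · exact ⟨by omega, hi.2⟩
  · exact ⟨hi.2, h hi⟩

/-- The lower density of the free digits is at least `2 / t`. -/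
theorem exists_mul_le_card_initialPart {t s : ℝ} (ht : 2 < t) (hs : 0 ≤ s) (hst : s * t < 2) :
    ∃ C : ℝ, ∀ m : ℕ, s * m ≤ (initialPart (freeDigits t) m).card + C := by
  have hs1 : s ≤ 1 := by nlinarith
  -- From `K` on, the surplus `(2 - s * t) * blockEnd t k` absorbs `blockStart t k` and the rounding
  -- terms.
  obtain ⟨K, hK⟩ := exists_nat_ge ((s * t + s + 1) / (2 - s * t))
  rw [div_le_iff₀ (by linarith)] at hK
  refine ⟨s * blockStart t K, ?_⟩
  have hC : 0 ≤ s * blockStart t K := by positivity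
  have key : ∀ k, K ≤ k → ∀ m : ℕ, m ≤ blockStart t k →
      s * m ≤ (initialPart (freeDigits t) m).card + s * blockStart t K := by
    intro k hk
    induction k, hk using Nat.le_induction with
    | base =>
      intro m hm
      have : s * m ≤ s * blockStart t K := by gcongr
      have : (0 : ℝ) ≤ (initialPart (freeDigits t) m).card := by positivity
      linarith
    | succ k hk ih =>
      intro m hm
      rcases le_or_gt m (blockStart t k) with h₁ | h₁
      · exact ih m h₁
      rcases le_or_gt m (2 * blockEnd t k) with h₂ | h₂
      -- Inside a block every new position is free, and `s ≤ 1`.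
      · have h₃ := card_initialPart_add_le h₁.le
          ((Ico_subset_Ico_right h₂).trans (Ico_subset_freeDigits t k))
        have h₄ := ih _ le_rfl
        have h₅ : ((initialPart (freeDigits t) (blockStart t k)).card : ℝ) + (m - blockStart t k) ≤
            (initialPart (freeDigits t) m).card := by
          rw [← Nat.cast_sub h₁.le]
          exact_mod_cast h₃
        have h₆ : (blockStart t k : ℝ) ≤ m := by exact_mod_cast h₁.le
        nlinarith
      -- In a gap the count is at least that of the last block alone, and the worst case is the end
      -- of the gap.
      · have hlt := blockStart_lt_blockEnd t k
        have h₃ := card_initialPart_add_le (by omega) (Ico_subset_freeDigits t k)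
        have h₄ := card_initialPart_mono (freeDigits t) h₂.le
        have h₅ : 2 * blockEnd t k ≤ (initialPart (freeDigits t) m).card + blockStart t k := by
          simp only at h₄
          omega
        have h₆ : (2 * blockEnd t k : ℝ) ≤
            (initialPart (freeDigits t) m).card + blockStart t k := by
          exact_mod_cast h₅
        have h₇ := blockStart_succ_le ht k
        have h₈ : (m : ℝ) ≤ blockStart t (k + 1) := by exact_mod_cast hm
        have h₉ : s * m ≤ s * (t * ((blockEnd t k : ℝ) + 1) + 1) := by
          gcongr
          linarith
        have hn : (blockEnd t k : ℝ) = (k + 1) * (blockStart t k + 1) := by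
          rw [blockEnd]; push_cast; ring
        have hk' : (K : ℝ) ≤ k + 1 := by exact_mod_cast hk.trans (Nat.le_succ k)
        have h₁₀ : (s * t + s + 1) ≤ (k + 1) * (2 - s * t) :=
          hK.trans (by gcongr)
        have hc : (0 : ℝ) ≤ blockStart t k := by positivity
        have h₁₁ : (s * t + s + 1) * (blockStart t k + 1) ≤ (2 - s * t) * blockEnd t k := by
          rw [hn]
          calc _ ≤ ((k + 1) * (2 - s * t)) * ((blockStart t k : ℝ) + 1) := by gcongr
            _ = _ := by ring
        have : 0 ≤ (s * t + s) * blockStart t k := by positivity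
        nlinarith
  intro m
  refine key (max K m) (le_max_left _ _) m ?_
  exact (le_max_right K m).trans (le_blockStart ht _)
-- Hausdorff dimension: lower bound by a mass distribution
open MeasureTheory

/-- The law of a sequence of independent fair binary digits. -/
noncomputable def coinMeasure : Measure (ℕ → Fin 2) :=
  Measure.infinitePi fun _ => (PMF.uniformOfFintype (Fin 2)).toMeasure

instance : IsProbabilityMeasure coinMeasure := by
  unfold coinMeasure; infer_instance

/-- A prefix determines all free digits below `m`, so the event lies in a cylinder fixing that many
fair digits. An integer `j` allows the possibly negative values arising from ceilings below. -/
theorem coinMeasure_prefixNum_le (S : Set ℕ) (m : ℕ) (j : ℤ) :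
    coinMeasure {b | (prefixNum (maskDigits S b) m : ℤ) = j} ≤
      (2⁻¹ : ENNReal) ^ (initialPart S m).card := by
  rcases eq_empty_or_nonempty {b | (prefixNum (maskDigits S b) m : ℤ) = j} with h | ⟨b₀, hb₀⟩
  · simp [h]
  have hsub : {b | (prefixNum (maskDigits S b) m : ℤ) = j} ⊆
      Set.pi (initialPart S m : Set ℕ) fun i => {b₀ i} := by
    intro b hb i hi
    have hi' := mem_initialPart.1 (Finset.mem_coe.1 hi)
    have h : prefixNum (maskDigits S b) m = prefixNum (maskDigits S b₀) m := by
      rw [mem_ofPred_eq] at hb hb₀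
      omega
    have := eq_of_prefixNum_eq h i hi'.1
    rwa [maskDigits_of_mem _ hi'.2, maskDigits_of_mem _ hi'.2] at this
  refine (measure_mono hsub).trans ?_
  rw [coinMeasure, Measure.infinitePi_pi _ fun i _ => measurableSet_singleton _]
  simp

/-- Digits whose value falls in the ball have a prefix in `[2^m x - 2, 2^m x + 1]`, which leaves at
most four integers. -/
theorem coinMeasure_preimage_closedBall_le (S : Set ℕ) (m : ℕ) (x : ℝ) :
    coinMeasure ((fun b => Real.ofDigits (maskDigits S b)) ⁻¹'
        Metric.closedBall x ((1 / 2 : ℝ) ^ m)) ≤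
      4 * (2⁻¹ : ENNReal) ^ (initialPart S m).card := by
  have hsub : (fun b => Real.ofDigits (maskDigits S b)) ⁻¹' Metric.closedBall x ((1 / 2 : ℝ) ^ m) ⊆
      ⋃ i ∈ Finset.range 4,
        {b | (prefixNum (maskDigits S b) m : ℤ) = ⌈2 ^ m * x⌉ - 2 + (i : ℤ)} := by
    intro b hb
    rw [mem_preimage, Metric.mem_closedBall, Real.dist_eq, abs_le] at hb
    have h₁ := prefixNum_div_le_ofDigits (maskDigits S b) m
    have h₂ := ofDigits_le_prefixNum_div (maskDigits S b) m
    have hp : (0 : ℝ) < 2 ^ m := by positivity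
    rw [div_le_iff₀ hp] at h₁
    rw [le_div_iff₀ hp] at h₂
    have hq : (1 / 2 : ℝ) ^ m * 2 ^ m = 1 := by rw [← mul_pow]; norm_num
    have h₃ : (prefixNum (maskDigits S b) m : ℝ) ≤ 2 ^ m * x + 1 := by nlinarith
    have h₄ : 2 ^ m * x - 2 ≤ (prefixNum (maskDigits S b) m : ℝ) := by nlinarith
    have h₅ : ⌈2 ^ m * x⌉ - 2 ≤ (prefixNum (maskDigits S b) m : ℤ) := by
      rw [sub_le_iff_le_add, Int.ceil_le]
      push_cast
      linarith
    have h₆ : (prefixNum (maskDigits S b) m : ℤ) ≤ ⌈2 ^ m * x⌉ + 1 := by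
      have := Int.le_ceil (2 ^ m * x)
      have : ((prefixNum (maskDigits S b) m : ℤ) : ℝ) ≤ ((⌈2 ^ m * x⌉ + 1 : ℤ) : ℝ) := by
        push_cast
        linarith
      exact_mod_cast this
    simp only [mem_iUnion, Finset.mem_range, mem_ofPred_eq]
    exact ⟨((prefixNum (maskDigits S b) m : ℤ) - (⌈2 ^ m * x⌉ - 2)).toNat, by omega, by omega⟩
  refine (measure_mono hsub).trans ((measure_biUnion_finset_le _ _).trans ?_)
  refine (Finset.sum_le_sum fun i _ => coinMeasure_prefixNum_le S m _).trans ?_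
  simp

theorem coinMeasure_preimage_closedBall_le_rpow {S : Set ℕ} {s C : ℝ}
    (h : ∀ m : ℕ, s * m ≤ (initialPart S m).card + C) (m : ℕ) (x : ℝ) :
    coinMeasure ((fun b => Real.ofDigits (maskDigits S b)) ⁻¹'
        Metric.closedBall x ((1 / 2 : ℝ) ^ m)) ≤
      ENNReal.ofReal (4 * 2 ^ C * ((1 / 2 : ℝ) ^ m) ^ s) := by
  refine (coinMeasure_preimage_closedBall_le S m x).trans ?_
  have h₁ : 4 * (2⁻¹ : ENNReal) ^ (initialPart S m).card =
      ENNReal.ofReal (4 * (2⁻¹ : ℝ) ^ (initialPart S m).card) := by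
    rw [ENNReal.ofReal_mul (by norm_num), ENNReal.ofReal_pow (by norm_num),
      ENNReal.ofReal_inv_of_pos (by norm_num)]
    norm_num
  rw [h₁]
  refine ENNReal.ofReal_le_ofReal ?_
  rw [mul_assoc]
  gcongr
  have h₂ : ((1 / 2 : ℝ) ^ m) ^ s = 2 ^ (-(s * m)) := by
    rw [← Real.rpow_natCast, ← Real.rpow_mul (by norm_num), one_div, Real.inv_rpow (by norm_num),
      ← Real.rpow_neg (by norm_num), mul_comm]
  rw [h₂, ← Real.rpow_add (by norm_num), inv_pow, ← Real.rpow_natCast,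
    ← Real.rpow_neg (by norm_num)]
  exact Real.rpow_le_rpow_of_exponent_le (by norm_num) (by linarith [h m])

theorem map_coinMeasure_le {S : Set ℕ} {s C : ℝ} (hs : 0 < s)
    (h : ∀ m : ℕ, s * m ≤ (initialPart S m).card + C) (U : Set ℝ) (hU : Metric.ediam U ≤ 1) :
    coinMeasure.map (fun b => Real.ofDigits (maskDigits S b)) U ≤
      ENNReal.ofReal (4 * 2 ^ C * 2 ^ s) * Metric.ediam U ^ s := by
  rcases U.eq_empty_or_nonempty with rfl | ⟨x, hx⟩
  · simp
  have hmeas : Measurable fun b : ℕ → Fin 2 => Real.ofDigits (maskDigits S b) :=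
    (continuous_ofDigits_maskDigits S).measurable
  obtain ⟨d, hd⟩ : ∃ d, d = (Metric.ediam U).toReal := ⟨_, rfl⟩
  have hfin : Metric.ediam U ≠ ⊤ := ne_top_of_le_ne_top ENNReal.one_ne_top hU
  have hUd : Metric.ediam U = ENNReal.ofReal d := by rw [hd, ENNReal.ofReal_toReal hfin]
  have hd0 : 0 ≤ d := hd ▸ ENNReal.toReal_nonneg
  have hd1 : d ≤ 1 := by
    rw [hd]; simpa using ENNReal.toReal_mono ENNReal.one_ne_top hU
  have hball : ∀ m : ℕ, d ≤ (1 / 2 : ℝ) ^ m →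
      coinMeasure.map (fun b => Real.ofDigits (maskDigits S b)) U ≤
        ENNReal.ofReal (4 * 2 ^ C * ((1 / 2 : ℝ) ^ m) ^ s) := by
    intro m hm
    have hsub : U ⊆ Metric.closedBall x ((1 / 2 : ℝ) ^ m) := by
      intro y hy
      have h₁ := Metric.edist_le_ediam_of_mem hy hx
      rw [hUd, edist_dist, ENNReal.ofReal_le_ofReal_iff hd0] at h₁
      exact Metric.mem_closedBall.2 (h₁.trans hm)
    refine (measure_mono hsub).trans ?_
    rw [Measure.map_apply hmeas Metric.isClosed_closedBall.measurableSet]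
    exact coinMeasure_preimage_closedBall_le_rpow h m x
  rcases hd0.eq_or_lt with h0 | h0
  -- Diameter zero: every scale `m` is available, and the bound tends to 0 because `s > 0`.
  · have hlim : Tendsto (fun m : ℕ => ENNReal.ofReal (4 * 2 ^ C * ((1 / 2 : ℝ) ^ m) ^ s)) atTop
        (𝓝 0) := by
      rw [← ENNReal.ofReal_zero]
      refine ENNReal.tendsto_ofReal ?_
      have h₁ : Tendsto (fun m : ℕ => ((1 / 2 : ℝ) ^ m) ^ s) atTop (𝓝 (0 ^ s)) :=
        (tendsto_pow_atTop_nhds_zero_of_lt_one (by norm_num) (by norm_num)).rpow_const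
          (Or.inr hs.le)
      rw [Real.zero_rpow hs.ne'] at h₁
      simpa using h₁.const_mul (4 * 2 ^ C)
    have := ge_of_tendsto hlim (Eventually.of_forall fun m => hball m (by rw [← h0]; positivity))
    exact this.trans zero_le
  -- With `2^(-m-1) < d ≤ 2^(-m)`, replacing the dyadic radius by `d` costs the factor `2^s`.
  · obtain ⟨m, hm₁, hm₂⟩ :=
      exists_nat_pow_near_of_lt_one h0 hd1 (y := (1 / 2 : ℝ)) (by norm_num) (by norm_num)
    refine (hball m hm₂).trans ?_
    rw [hUd, ENNReal.ofReal_rpow_of_pos h0, ← ENNReal.ofReal_mul (by positivity)]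
    refine ENNReal.ofReal_le_ofReal ?_
    rw [mul_assoc (4 * 2 ^ C), ← Real.mul_rpow (by norm_num) hd0]
    gcongr
    rw [pow_succ] at hm₁
    linarith

/-- Mass distribution principle: the law of the random point gives the set mass 1 and is bounded by
a multiple of the `s`-dimensional Hausdorff measure. -/
theorem le_dimH_digitSet {S : Set ℕ} {s : NNReal} {C : ℝ} (hs : 0 < s)
    (h : ∀ m : ℕ, s * m ≤ (initialPart S m).card + C) : (s : ENNReal) ≤ dimH (digitSet S) := by
  refine le_dimH_of_hausdorffMeasure_ne_zero ?_
  have hmeas : Measurable fun b : ℕ → Fin 2 => Real.ofDigits (maskDigits S b) :=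
    (continuous_ofDigits_maskDigits S).measurable
  obtain ⟨K, hK⟩ : ∃ K, K = ENNReal.ofReal (4 * 2 ^ C * 2 ^ (s : ℝ)) := ⟨_, rfl⟩
  have hK0 : K ≠ 0 := by
    rw [hK]
    have : (0 : ℝ) < 4 * 2 ^ C * 2 ^ (s : ℝ) := by positivity
    simpa using this
  have hKt : K ≠ ⊤ := by rw [hK]; exact ENNReal.ofReal_ne_top
  have hle : K⁻¹ • coinMeasure.map (fun b => Real.ofDigits (maskDigits S b)) ≤
      Measure.hausdorffMeasure (s : ℝ) := by
    refine Measure.le_hausdorffMeasure _ _ 1 one_pos fun U hU => ?_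
    rw [Measure.smul_apply, smul_eq_mul]
    calc _ ≤ K⁻¹ * (K * Metric.ediam U ^ (s : ℝ)) := by
          gcongr
          rw [hK]
          exact map_coinMeasure_le (by exact_mod_cast hs) h U hU
      _ = _ := by rw [← mul_assoc, ENNReal.inv_mul_cancel hK0 hKt, one_mul]
  have h₁ := hle (digitSet S)
  rw [Measure.smul_apply, smul_eq_mul,
    Measure.map_apply hmeas (isCompact_digitSet S).isClosed.measurableSet] at h₁
  have h₂ : (fun b : ℕ → Fin 2 => Real.ofDigits (maskDigits S b)) ⁻¹' digitSet S = univ :=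
    eq_univ_of_forall fun b => ⟨b, rfl⟩
  rw [h₂, measure_univ, mul_one] at h₁
  intro h0
  rw [h0] at h₁
  exact hKt (by simpa using h₁)

theorem le_dimH_digitSet_freeDigits {t : ℝ} (ht : 2 < t) :
    ENNReal.ofReal (2 / t) ≤ dimH (digitSet (freeDigits t)) := by
  refine ENNReal.le_of_forall_nnreal_lt fun s hs => ?_
  rcases eq_or_ne s 0 with rfl | hs0
  · simp
  have hst : (s : ℝ) < 2 / t := by
    rwa [ENNReal.ofReal, ENNReal.coe_lt_coe, Real.lt_toNNReal_iff_coe_lt] at hs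
  rw [lt_div_iff₀ (by linarith)] at hst
  obtain ⟨C, hC⟩ := exists_mul_le_card_initialPart ht s.coe_nonneg hst
  exact le_dimH_digitSet (pos_iff_ne_zero.2 hs0) hC

/-! ### Hausdorff dimension: upper bound by covers at the gaps -/

/-- Truncating at `2 * blockEnd t k` gives `4^n` balls of radius `2^(-m)`, where `n = blockEnd t k`
and `m = blockStart t (k + 1) ≥ t (n + 1)`. The sum of the diameters to the power `2/t` is then at
most 2. -/
theorem dimH_digitSet_freeDigits_le {t : ℝ} (ht : 2 < t) :
    dimH (digitSet (freeDigits t)) ≤ ENNReal.ofReal (2 / t) := by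
  refine dimH_le_of_hausdorffMeasure_ne_top (d := (2 / t).toNNReal) ?_
  rw [Real.coe_toNNReal _ (by positivity)]
  have htend : Tendsto (fun k : ℕ => ENNReal.ofReal (2 * (1 / 2) ^ k)) atTop (𝓝 0) := by
    rw [← ENNReal.ofReal_zero]
    refine ENNReal.tendsto_ofReal ?_
    simpa using (tendsto_pow_atTop_nhds_zero_of_lt_one (r := (1 / 2 : ℝ)) (by norm_num)
      (by norm_num)).const_mul 2
  have hdiam : ∀ (k j : ℕ), Metric.ediam (Metric.closedBall
      ((j : ℝ) / 2 ^ (2 * blockEnd t k)) ((2 : ℝ) ^ blockStart t (k + 1))⁻¹) =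
      ENNReal.ofReal (2 * ((2 : ℝ) ^ blockStart t (k + 1))⁻¹) := by
    intro k j
    rw [Real.closedBall_eq_Icc, Real.ediam_Icc]
    congr 1
    ring
  have key := Measure.hausdorffMeasure_le_liminf_sum (2 / t) (digitSet (freeDigits t))
    (l := atTop) (ι := fun k => Fin (2 ^ (2 * blockEnd t k)))
    (fun k : ℕ => ENNReal.ofReal (2 * (1 / 2) ^ k)) htend
    (fun k j => Metric.closedBall ((j : ℕ) / 2 ^ (2 * blockEnd t k) : ℝ)
      ((2 : ℝ) ^ blockStart t (k + 1))⁻¹)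
    (Eventually.of_forall fun k j => by
      rw [hdiam]
      refine ENNReal.ofReal_le_ofReal ?_
      rw [← inv_pow, inv_eq_one_div]
      have h₁ := two_mul_blockEnd_le ht k
      have h₂ := lt_blockEnd t k
      exact mul_le_mul_of_nonneg_left
        (pow_le_pow_of_le_one (by norm_num) (by norm_num) (by omega)) (by norm_num))
    (Eventually.of_forall fun k => by
      rintro _ ⟨a, rfl⟩
      refine mem_iUnion.2 ⟨⟨_, prefixNum_lt (maskDigits (freeDigits t) a) _⟩, ?_⟩
      rw [Metric.mem_closedBall, Real.dist_eq]
      exact abs_ofDigits_sub_prefixNum_le fun i h₁ h₂ =>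
        maskDigits_of_notMem a (notMem_freeDigits ht h₁ h₂))
  refine ne_top_of_le_ne_top (ENNReal.ofReal_ne_top (r := 2)) (key.trans ?_)
  refine liminf_le_of_le (by isBoundedDefault) fun b hb => ?_
  obtain ⟨k, hk⟩ := hb.exists
  refine hk.trans ?_
  simp only [hdiam, Finset.sum_const, Finset.card_univ, Fintype.card_fin, nsmul_eq_mul]
  rw [ENNReal.ofReal_rpow_of_pos (by positivity), ← ENNReal.ofReal_natCast,
    ← ENNReal.ofReal_mul (by positivity)]
  refine ENNReal.ofReal_le_ofReal ?_
  have hmul : ((2 : ℝ) ^ blockStart t (k + 1))⁻¹ ≤ 2 ^ (-(t * (blockEnd t k + 1) : ℝ)) := by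
    rw [Real.rpow_neg (by norm_num), ← Real.rpow_natCast]
    gcongr
    · norm_num
    · exact mul_blockEnd_le t k
  have ht0 : 0 < t := by linarith
  calc ((2 ^ (2 * blockEnd t k) : ℕ) : ℝ) * (2 * ((2 : ℝ) ^ blockStart t (k + 1))⁻¹) ^ (2 / t)
      ≤ ((2 ^ (2 * blockEnd t k) : ℕ) : ℝ) * (2 * 2 ^ (-(t * (blockEnd t k + 1) : ℝ))) ^ (2 / t) := by
        gcongr
    _ = 2 ^ ((2 * blockEnd t k : ℕ) : ℝ) *
          (2 ^ (2 / t) * 2 ^ (-(2 * (blockEnd t k + 1) : ℝ))) := by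
        rw [Real.mul_rpow (by norm_num) (by positivity), ← Real.rpow_mul (by norm_num),
          Real.rpow_natCast]
        push_cast
        congr 3
        field_simp
    _ = 2 ^ (2 / t - 2) := by
        rw [← Real.rpow_add (by norm_num), ← Real.rpow_add (by norm_num)]
        push_cast
        congr 1
        ring
    _ ≤ 2 ^ (1 : ℝ) := by
        refine Real.rpow_le_rpow_of_exponent_le (by norm_num) ?_
        have : 2 / t ≤ 1 := by rw [div_le_one ht0]; exact ht.le
        linarith
    _ = 2 := Real.rpow_one 2

theorem dimH_digitSet_freeDigits {t : ℝ} (ht : 2 < t) :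
    dimH (digitSet (freeDigits t)) = ENNReal.ofReal (2 / t) :=
  (dimH_digitSet_freeDigits_le ht).antisymm (le_dimH_digitSet_freeDigits ht)

/-! ### Choosing the abstract rationals -/

theorem exists_maximal_rSeparated {X : Type*} [MetricSpace X] {r : ℝ} {F A : Set X} (hAF : A ⊆ F)
    (hA : RSeparated r A) :
    ∃ M, A ⊆ M ∧ Maximal (fun B : Set X => B ⊆ F ∧ RSeparated r B) M := by
  refine zorn_subset_nonempty {B : Set X | B ⊆ F ∧ RSeparated r B} ?_ A ⟨hAF, hA⟩
  intro c hc hchain _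
  refine ⟨⋃₀ c, ⟨sUnion_subset fun B hB => (hc hB).1, ?_⟩, fun B hB => subset_sUnion_of_mem hB⟩
  rintro x ⟨B, hB, hx⟩ y ⟨B', hB', hy⟩ hxy
  rcases hchain.total hB hB' with h | h
  · exact (hc hB').2 x (h hx) y hy hxy
  · exact (hc hB).2 x hx y (h hy) hxy

/-- The points `j / 4ⁿ` of `F` with `j ≡ q` modulo `2ⁿ`, where `2ⁿ ≤ q < 2ⁿ⁺¹`. -/
def congruentPoints (F : Set ℝ) (q : ℕ) : Set ℝ :=
  {z ∈ F | ∃ j : ℕ, z = j / 2 ^ (2 * Nat.log 2 q) ∧ j ≡ q [MOD 2 ^ Nat.log 2 q]}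

/-- Distinct numerators congruent modulo `2^n` differ by at least `2^n`, so the points are at least
`2^n / 4^n = 2^(-n) ≥ 1/q` apart. -/
theorem rSeparated_congruentPoints (F : Set ℝ) {q : ℕ} (hq : 1 ≤ q) :
    RSeparated (1 / (q : ℝ)) (congruentPoints F q) := by
  rintro _ ⟨_, i, rfl, hi⟩ _ ⟨_, j, rfl, hj⟩ hne
  obtain ⟨n, hn⟩ : ∃ n, n = Nat.log 2 q := ⟨_, rfl⟩
  rw [← hn] at hi hj hne ⊢
  have hq' : (2 : ℝ) ^ n ≤ q := by
    have := Nat.pow_log_le_self 2 (show q ≠ 0 by omega)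
    rw [← hn] at this
    exact_mod_cast this
  have hdvd : ((2 ^ n : ℕ) : ℤ) ∣ (i : ℤ) - j := (hj.trans hi.symm).dvd
  have hne' : (i : ℤ) - j ≠ 0 := by
    intro h
    have : i = j := by omega
    exact hne (by rw [this])
  have h₁ : ((2 ^ n : ℕ) : ℤ) ≤ |(i : ℤ) - j| :=
    Int.le_of_dvd (abs_pos.2 hne') ((dvd_abs _ _).2 hdvd)
  have h₂ : (2 : ℝ) ^ n ≤ |(i : ℝ) - j| := by exact_mod_cast h₁
  have hp : (0 : ℝ) < 2 ^ n := by positivity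
  rw [Real.dist_eq, ← sub_div, abs_div, abs_of_pos (show (0 : ℝ) < 2 ^ (2 * n) by positivity)]
  calc 1 / (q : ℝ) ≤ 1 / 2 ^ n := by gcongr
    _ = 2 ^ n / 2 ^ (2 * n) := by rw [two_mul, pow_add]; field_simp
    _ ≤ _ := by gcongr

theorem approxSet_digitSet_freeDigits {t : ℝ} (ht : 2 < t) {P : ℕ → Set ℝ}
    (hP : ∀ q, 1 ≤ q → congruentPoints (digitSet (freeDigits t)) q ⊆ P q) :
    approxSet (digitSet (freeDigits t)) P t = digitSet (freeDigits t) := by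
  refine (sep_subset _ _).antisymm fun x hx => ⟨hx, fun N => ?_⟩
  obtain ⟨a, rfl⟩ := hx
  obtain ⟨n, hn⟩ : ∃ n, n = blockEnd t N := ⟨_, rfl⟩
  obtain ⟨j, hj⟩ : ∃ j, j = prefixNum (maskDigits (freeDigits t) a) (2 * n) := ⟨_, rfl⟩
  have hpos : 0 < 2 ^ n := by positivity
  have hmod := Nat.mod_lt j hpos
  have hlog : Nat.log 2 (2 ^ n + j % 2 ^ n) = n :=
    Nat.log_eq_of_pow_le_of_lt_pow (by omega) (by rw [pow_succ]; omega)
  have hNn : N < 2 ^ n := (lt_blockEnd t N).trans (hn ▸ Nat.lt_two_pow_self)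
  -- This `q` is the representative of the class of `j` modulo `2^n` in `[2^n, 2^(n+1))`, so the
  -- truncation belongs to `congruentPoints`.
  refine ⟨2 ^ n + j % 2 ^ n, by omega, (j : ℝ) / 2 ^ (2 * n), hP _ (by omega) ⟨?_, j, ?_, ?_⟩, ?_⟩
  · rw [hj]
    exact prefixNum_div_mem_digitSet _ a _
  · rw [hlog]
  · rw [hlog]
    simp [Nat.ModEq]
  · rw [dist_comm, Real.dist_eq, hj]
    refine (abs_ofDigits_sub_prefixNum_le (m := blockStart t (N + 1)) fun i h₁ h₂ =>
      maskDigits_of_notMem a (notMem_freeDigits ht (hn ▸ h₁) h₂)).trans ?_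
    rw [← hj, ← one_div]
    have hq : ((2 ^ n + j % 2 ^ n : ℕ) : ℝ) ≤ 2 ^ ((n : ℝ) + 1) := by
      rw [Real.rpow_add_one (by norm_num), Real.rpow_natCast]
      have : 2 ^ n + j % 2 ^ n ≤ 2 ^ n * 2 := by omega
      exact_mod_cast this
    refine one_div_le_one_div_of_le (Real.rpow_pos_of_pos (by positivity) _) ?_
    calc ((2 ^ n + j % 2 ^ n : ℕ) : ℝ) ^ t ≤ (2 ^ ((n : ℝ) + 1)) ^ t := by
          gcongr
      _ = 2 ^ (t * ((n : ℝ) + 1)) := by rw [← Real.rpow_mul (by norm_num), mul_comm]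
      _ ≤ 2 ^ (blockStart t (N + 1) : ℝ) := by
          refine Real.rpow_le_rpow_of_exponent_le (by norm_num) ?_
          rw [hn]
          exact mul_blockEnd_le t N
      _ = _ := Real.rpow_natCast _ _

/-! ### Box and packing dimensions -/

theorem encard_le_sepNumber {X : Type*} [MetricSpace X] {r : ℝ} {A S : Set X} (hSA : S ⊆ A)
    (hS : RSeparated r S) : S.encard ≤ sepNumber r A :=
  le_iSup_of_le S (le_iSup_of_le hSA (le_iSup_of_le hS le_rfl))

theorem sepNumber_le_of_subset_Icc {A : Set ℝ} (hA : A ⊆ Icc 0 1) {r : ℝ} (hr : 0 < r) :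
    sepNumber r A ≤ ((⌊1 / r⌋₊ + 1 : ℕ) : ℕ∞) := by
  refine iSup_le fun S => iSup_le fun hSA => iSup_le fun hS => ?_
  have hmaps : MapsTo (fun x : ℝ => ⌊x / r⌋₊) S (Finset.range (⌊1 / r⌋₊ + 1) : Set ℕ) := by
    intro x hx
    rw [Finset.mem_coe, Finset.mem_range, Nat.lt_succ_iff]
    refine Nat.floor_le_floor ?_
    have := (hA (hSA hx)).2
    gcongr
  have hinj : InjOn (fun x : ℝ => ⌊x / r⌋₊) S := by
    intro x hx y hy hxy
    by_contra hne
    have h := hS x hx y hy hne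
    have hx0 : 0 ≤ x / r := div_nonneg (hA (hSA hx)).1 hr.le
    have hy0 : 0 ≤ y / r := div_nonneg (hA (hSA hy)).1 hr.le
    have h₁ := Nat.floor_le hx0
    have h₂ := Nat.lt_floor_add_one (x / r)
    have h₃ := Nat.floor_le hy0
    have h₄ := Nat.lt_floor_add_one (y / r)
    simp only at hxy
    rw [hxy] at h₁ h₂
    have h₅ : |x / r - y / r| < 1 := abs_lt.2 ⟨by linarith, by linarith⟩
    rw [← sub_div, abs_div, abs_of_pos hr, div_lt_one hr] at h₅
    rw [Real.dist_eq] at h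
    linarith
  calc S.encard ≤ (Finset.range (⌊1 / r⌋₊ + 1) : Set ℕ).encard :=
        encard_le_encard_of_injOn hmaps hinj
    _ = _ := by rw [encard_coe_eq_coe_finsetCard, Finset.card_range]

theorem upperBoxDim_le_one {A : Set ℝ} (hA : A ⊆ Icc 0 1) : upperBoxDim A ≤ 1 := by
  have hlim : Tendsto (fun r : ℝ => (((Real.log 2 - Real.log r) / -Real.log r : ℝ) : EReal))
      (𝓝[>] 0) (𝓝 ((1 : ℝ) : EReal)) := by
    refine (continuous_coe_real_ereal.tendsto 1).comp ?_
    have h₁ : Tendsto (fun r : ℝ => -Real.log r) (𝓝[>] 0) atTop :=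
      tendsto_neg_atBot_atTop.comp Real.tendsto_log_nhdsGT_zero
    have h₂ : Tendsto (fun r : ℝ => Real.log 2 / -Real.log r + 1) (𝓝[>] 0) (𝓝 (0 + 1)) :=
      (h₁.const_div_atTop _).add_const 1
    rw [zero_add] at h₂
    refine h₂.congr' ?_
    filter_upwards [h₁.eventually_gt_atTop 0] with r hr
    rw [sub_eq_add_neg, add_div, div_self hr.ne']
  refine (limsup_le_limsup ?_ (by isBoundedDefault) (by isBoundedDefault)).trans
    (hlim.limsup_eq.le.trans_eq EReal.coe_one)
  filter_upwards [Ioo_mem_nhdsGT (zero_lt_one' ℝ)] with r hr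
  have hlog : 0 < -Real.log r := by
    have := Real.log_neg hr.1 hr.2
    linarith
  rw [EReal.coe_div]
  refine EReal.div_le_div_right_of_nonneg (by exact_mod_cast hlog.le) ?_
  have h₁ : (sepNumber r A : ENNReal) ≤ ENNReal.ofReal (2 / r) := by
    calc (sepNumber r A : ENNReal) ≤ (((⌊1 / r⌋₊ + 1 : ℕ) : ℕ∞) : ENNReal) := by
          exact_mod_cast sepNumber_le_of_subset_Icc hA hr.1
      _ = ENNReal.ofReal ((⌊1 / r⌋₊ + 1 : ℕ) : ℝ) := by
          rw [ENNReal.ofReal_natCast]; rfl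
      _ ≤ _ := by
          refine ENNReal.ofReal_le_ofReal ?_
          have h₂ := Nat.floor_le (show 0 ≤ 1 / r from (one_div_pos.2 hr.1).le)
          have h₃ : 1 ≤ 1 / r := by rw [le_div_iff₀ hr.1]; linarith [hr.2]
          push_cast
          rw [show 2 / r = 1 / r + 1 / r by ring]
          linarith
  refine (ENNReal.log_le_log h₁).trans_eq ?_
  rw [ENNReal.log_ofReal_of_pos (div_pos two_pos hr.1), Real.log_div two_ne_zero hr.1.ne']

theorem packingDim_le_one {A : Set ℝ} (hA : A ⊆ Icc 0 1) : packingDim A ≤ 1 :=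
  iInf₂_le_of_le (fun _ => A) (iUnion_const A).symm (iSup_le fun _ => upperBoxDim_le_one hA)

/-- A set whose closure contains `M` consecutive multiples of `δ` has `M` points which are
`δ / 2`-separated. -/
theorem le_sepNumber_of_mem_closure {B : Set ℝ} {δ z : ℝ} (hδ : 0 < δ) {M : ℕ}
    (h : ∀ j < M, z + j * δ ∈ closure B) : (M : ℕ∞) ≤ sepNumber (δ / 2) B := by
  -- Moving each point by less than `δ / 4` costs less than `δ / 2` of the spacing `δ`.
  have h' : ∀ j : Fin M, ∃ y ∈ B, dist (z + (j : ℕ) * δ) y < δ / 4 := fun j =>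
    Metric.mem_closure_iff.1 (h j j.isLt) _ (by positivity)
  choose y hyB hy using h'
  have hsep : ∀ i j : Fin M, i ≠ j → δ / 2 ≤ dist (y i) (y j) := by
    intro i j hij
    have h₁ : (1 : ℝ) ≤ |((i : ℕ) : ℝ) - ((j : ℕ) : ℝ)| := by
      have h₂ : (1 : ℤ) ≤ |((i : ℕ) : ℤ) - ((j : ℕ) : ℤ)| :=
        Int.one_le_abs fun h₃ => hij (Fin.ext (by omega))
      exact_mod_cast h₂
    have h₂ : δ ≤ dist (z + (i : ℕ) * δ) (z + (j : ℕ) * δ) := by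
      rw [Real.dist_eq, add_sub_add_left_eq_sub, ← sub_mul, abs_mul, abs_of_pos hδ]
      nlinarith
    have h₃ := dist_triangle4 (z + (i : ℕ) * δ) (y i) (y j) (z + (j : ℕ) * δ)
    have h₄ := hy i
    have h₅ := hy j
    rw [dist_comm] at h₅
    linarith
  have hinj : Function.Injective y := by
    intro i j hij
    by_contra hne
    have := hsep i j hne
    rw [hij, dist_self] at this
    linarith
  have hcard : (range y).encard = M := by
    rw [← image_univ, hinj.encard_image, encard_univ]
    simp
  rw [← hcard]
  refine encard_le_sepNumber (range_subset_iff.2 hyB) ?_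
  rintro _ ⟨i, rfl⟩ _ ⟨j, rfl⟩ hne
  exact hsep i j fun h => hne (by rw [h])

/-- Fix the digits before the block, let those in it vary and put zeros after it: the resulting
points are consecutive multiples of `2^(-2n)`, where `n = blockEnd t k`. -/
theorem two_pow_le_sepNumber {t : ℝ} {B : Set ℝ} {N : ℕ} {a : ℕ → Fin 2}
    (hB : ∀ b : ℕ → Fin 2, (∀ i < N, b i = a i) →
      Real.ofDigits (maskDigits (freeDigits t) b) ∈ closure B)
    {k : ℕ} (hk : N ≤ blockStart t k) :
    ((2 ^ (2 * blockEnd t k - blockStart t k) : ℕ) : ℕ∞) ≤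
      sepNumber ((1 / 2) ^ (2 * blockEnd t k + 1)) B := by
  obtain ⟨l, hl⟩ : ∃ l, l = 2 * blockEnd t k - blockStart t k := ⟨_, rfl⟩
  have hml : blockStart t k + l = 2 * blockEnd t k := by
    have := blockStart_lt_blockEnd t k
    omega
  rw [← hl, pow_succ, mul_one_div]
  refine le_sepNumber_of_mem_closure (by positivity)
    (z := prefixNum (maskDigits (freeDigits t) a) (blockStart t k) * 2 ^ l *
      (1 / 2) ^ (2 * blockEnd t k)) fun j hj => ?_
  obtain ⟨b, hb₁, hb₂, hb₃⟩ :=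
    exists_digits_block (maskDigits (freeDigits t) a) (blockStart t k) l hj
  rw [hml] at hb₂ hb₃
  -- `hB` asks for agreement with `a` itself, including digits that the mask erases, so `b` is
  -- corrected before the block.
  obtain ⟨b', hb'⟩ : ∃ b' : ℕ → Fin 2, b' = fun i => if i < blockStart t k then a i else b i :=
    ⟨_, rfl⟩
  have heq : maskDigits (freeDigits t) b' = b := by
    funext i
    by_cases hi : i ∈ freeDigits t
    · rw [maskDigits_of_mem _ hi, hb']
      by_cases him : i < blockStart t k
      · simp only [if_pos him]
        rw [hb₁ i him, maskDigits_of_mem _ hi]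
      · simp only [if_neg him]
    · rw [maskDigits_of_notMem _ hi]
      rcases lt_or_ge i (blockStart t k) with him | him
      · rw [hb₁ i him, maskDigits_of_notMem _ hi]
      · rw [hb₂ i (not_lt.1 fun h => hi (Ico_subset_freeDigits t k ⟨him, h⟩))]
  have := hB b' fun i hi => by rw [hb']; exact if_pos (hi.trans_le hk)
  rw [heq, ofDigits_eq_prefixNum_div hb₂, hb₃] at this
  convert this using 1
  push_cast
  rw [one_div, inv_pow]
  ring

/-- Along the scales `2^(-2n-1)`, with `n = (k+1)(m+1)` and `m = blockStart t k`, the ratio of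
logarithms is at least `(2n - m)/(2n + 1) ≥ 1 - 1/(k+1)`. -/
theorem one_le_upperBoxDim {t : ℝ} (ht : 2 < t) {B : Set ℝ} {N : ℕ} {a : ℕ → Fin 2}
    (hB : ∀ b : ℕ → Fin 2, (∀ i < N, b i = a i) →
      Real.ofDigits (maskDigits (freeDigits t) b) ∈ closure B) :
    1 ≤ upperBoxDim B := by
  have hr : Tendsto (fun k => (1 / 2 : ℝ) ^ (2 * blockEnd t k + 1)) atTop (𝓝[>] 0) := by
    refine tendsto_nhdsWithin_iff.2 ⟨?_, Eventually.of_forall fun k => by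
      rw [mem_Ioi]; positivity⟩
    refine (tendsto_pow_atTop_nhds_zero_of_lt_one (by norm_num) (by norm_num)).comp ?_
    exact tendsto_atTop_mono (fun k => by have := lt_blockEnd t k; rw [id]; omega) tendsto_id
  have hlim : Tendsto (fun k : ℕ => ((1 - 1 / ((k : ℝ) + 1) : ℝ) : EReal)) atTop
      (𝓝 ((1 : ℝ) : EReal)) := by
    refine (continuous_coe_real_ereal.tendsto 1).comp ?_
    simpa using (tendsto_one_div_add_atTop_nhds_zero_nat (𝕜 := ℝ)).const_sub 1
  refine le_of_forall_lt_imp_le_of_dense fun c hc => ?_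
  refine le_limsup_of_frequently_le' (hr.frequently (Eventually.frequently ?_))
  filter_upwards [hlim.eventually_const_lt (by exact_mod_cast hc), eventually_ge_atTop N]
    with k hk hNk
  refine hk.le.trans ?_
  have hlog : -Real.log ((1 / 2 : ℝ) ^ (2 * blockEnd t k + 1)) =
      (2 * blockEnd t k + 1) * Real.log 2 := by
    rw [Real.log_pow, one_div, Real.log_inv]
    push_cast
    ring
  have hlog2 := Real.log_pos one_lt_two
  have hden : 0 < (2 * blockEnd t k + 1) * Real.log 2 := by positivity
  rw [hlog, EReal.le_div_iff_mul_le (by exact_mod_cast hden) (EReal.coe_ne_top _),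
    ← EReal.coe_mul]
  have h₁ : ENNReal.ofReal (2 ^ (2 * blockEnd t k - blockStart t k)) ≤
      (sepNumber ((1 / 2) ^ (2 * blockEnd t k + 1)) B : ENNReal) := by
    have h₂ := two_pow_le_sepNumber hB (hNk.trans (le_blockStart ht k))
    calc ENNReal.ofReal (2 ^ (2 * blockEnd t k - blockStart t k))
        = (((2 ^ (2 * blockEnd t k - blockStart t k) : ℕ) : ℕ∞) : ENNReal) := by
          rw [ENNReal.ofReal_pow two_pos.le]
          simp
      _ ≤ _ := by exact_mod_cast h₂
  refine le_trans ?_ (ENNReal.log_le_log h₁)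
  have hlt := blockStart_lt_blockEnd t k
  rw [ENNReal.log_ofReal_of_pos (by positivity), EReal.coe_le_coe_iff, Real.log_pow,
    Nat.cast_sub (by omega), ← mul_assoc]
  gcongr
  have hn : (blockEnd t k : ℝ) = (k + 1) * (blockStart t k + 1) := by
    rw [blockEnd]; push_cast; ring
  have hk1 : (0 : ℝ) < k + 1 := by positivity
  have hdiv : 1 / ((k : ℝ) + 1) * blockEnd t k = blockStart t k + 1 := by
    rw [hn]; field_simp
  have : (0 : ℝ) ≤ 1 / ((k : ℝ) + 1) := by positivity
  have : (0 : ℝ) ≤ blockStart t k := by positivity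
  push_cast
  nlinarith

/-- Baire's theorem on the space of digit sequences: for any countable decomposition, the closure of
some piece contains the image of a whole cylinder, which already forces upper box dimension at least
1 for that piece. -/
theorem packingDim_digitSet_freeDigits {t : ℝ} (ht : 2 < t) :
    packingDim (digitSet (freeDigits t)) = 1 := by
  refine (packingDim_le_one (digitSet_subset_Icc _)).antisymm (le_iInf₂ fun B hB => ?_)
  have hclosed : ∀ i, IsClosed
      ((fun a : ℕ → Fin 2 => Real.ofDigits (maskDigits (freeDigits t) a)) ⁻¹' closure (B i)) :=
    fun i => isClosed_closure.preimage (continuous_ofDigits_maskDigits _)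
  have hcover : ⋃ i, ((fun a : ℕ → Fin 2 => Real.ofDigits (maskDigits (freeDigits t) a)) ⁻¹'
      closure (B i)) = univ := by
    refine eq_univ_of_forall fun a => ?_
    have ha : Real.ofDigits (maskDigits (freeDigits t) a) ∈ ⋃ i, B i := hB ▸ mem_range_self a
    obtain ⟨i, hi⟩ := mem_iUnion.1 ha
    exact mem_iUnion.2 ⟨i, subset_closure hi⟩
  obtain ⟨i, a, ha⟩ := nonempty_interior_of_iUnion_of_closed hclosed hcover
  obtain ⟨I, u, hu, hI⟩ := isOpen_pi_iff.1 isOpen_interior a ha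
  -- A basic open set constrains only the coordinates in the finite set `I`, so agreeing with `a` up
  -- to `I.sup id` suffices.
  refine le_iSup_of_le i (one_le_upperBoxDim ht (N := I.sup id + 1) (a := a) fun b hb => ?_)
  have hbI : b ∈ (I : Set ℕ).pi u := by
    intro j hj
    rw [hb j (Nat.lt_succ_of_le (Finset.le_sup (f := id) hj))]
    exact (hu j hj).2
  have hb' := interior_subset (hI hbI)
  exact hb'

theorem mainTheorem6 (t : ℝ) (ht : 2 < t) :
    ∃ (F : Set ℝ) (P : ℕ → Set ℝ),
      F.Nonempty ∧ IsCompact F ∧ F ⊆ Set.Icc (0 : ℝ) 1 ∧ IsAbstractRationals F P ∧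
      packingDim F = 1 ∧
      dimH (approxSet F P t) = dimH F ∧
      dimH F = ENNReal.ofReal (2 / t) ∧
      ((dimH F : ENNReal) : EReal) = (packingDim F + 1) / (t : EReal) ∧
      (dimH F + 1) / ENNReal.ofReal t < dimH (approxSet F P t) := by
  have ht0 : 0 < t := by linarith
  have hex : ∀ q : ℕ, ∃ M : Set ℝ, 1 ≤ q → congruentPoints (digitSet (freeDigits t)) q ⊆ M ∧
      Maximal (fun A : Set ℝ => A ⊆ digitSet (freeDigits t) ∧ RSeparated (1 / (q : ℝ)) A) M := by
    intro q
    by_cases hq : 1 ≤ q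
    · obtain ⟨M, hM⟩ := exists_maximal_rSeparated (sep_subset _ _)
        (rSeparated_congruentPoints (digitSet (freeDigits t)) hq)
      exact ⟨M, fun _ => hM⟩
    · exact ⟨∅, fun h => absurd h hq⟩
  choose P hP using hex
  have happrox := approxSet_digitSet_freeDigits ht fun q hq => (hP q hq).1
  refine ⟨digitSet (freeDigits t), P, digitSet_nonempty _, isCompact_digitSet _,
    digitSet_subset_Icc _, fun q hq => (hP q hq).2, packingDim_digitSet_freeDigits ht, ?_,
    dimH_digitSet_freeDigits ht, ?_, ?_⟩
  · rw [happrox]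
  · rw [dimH_digitSet_freeDigits ht, packingDim_digitSet_freeDigits ht,
      EReal.coe_ennreal_ofReal, max_eq_left (by positivity), EReal.coe_div]
    norm_num
    rfl
  · rw [happrox, dimH_digitSet_freeDigits ht, ← ENNReal.ofReal_one,
      ← ENNReal.ofReal_add (by positivity) zero_le_one, ← ENNReal.ofReal_div_of_pos ht0,
      ENNReal.ofReal_lt_ofReal_iff (by positivity)]
    -- The strict inequality `(2/t + 1)/t < 2/t` amounts to `2/t < 1`.
    have : 2 / t < 1 := by rwa [div_lt_one ht0]
    gcongr
    linarith
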